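/- Let $\mathcal{E}$ and $\mathcal{E}'$ be separable complex Hilbert spaces. For a contraction $A$ between Hilbert spaces let $D_A=(I-A^*A)^{1/2}$ be its defect operator and $\mathcal{D}_A$ the closure of the range of $D_A$. For contractions $A,B$ between the same two Hilbert spaces, $B$ is Shmul'yan dominated by $A$ if $B=A+D_{A^*}XD_A$ for some bounded operator $X:\mathcal{D}_A\to\mathcal{D}_{A^*}$. Let $H_1^\infty(\mathcal{E},\mathcal{E}')$ (the Schur class) be the set of analytic functions $F$ on the open unit disc $\mathbb{D}$ with values in the bounded operators $\mathcal{E}\to\mathcal{E}'$ such that $\|F\|_\infty=\sup_{\lambda\in\mathbb{D}}\|F(\lambda)\|\le 1$. For such $F$ let $T_F:H^2(\mathcal{E})\to H^2(\mathcal{E}')$ be the contraction between vector-valued Hardy spaces of the disc given by $(T_Fg)(\lambda)=F(\lambda)g(\lambda)$. For $F,G\in H_1^\infty(\mathcal{E},\mathcal{E}')$, $F$ is Shmul'yan–ter Horst dominated by $G$ if $T_F$ is Shmul'yan dominated by $T_G$; let $\Delta_\infty(F)$ be the set of all $G\in H_1^\infty(\mathcal{E},\mathcal{E}')$ such that each of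 $F$ and $G$ is Shmul'yan–ter Horst dominated by the other. Theorem. Let $T:\mathcal{E}\to\mathcal{E}'$ be a partial isometry, that is, a bounded operator with $TT^*T=T$, viewed as a constant function in $H_1^\infty(\mathcal{E},\mathcal{E}')$. Then $$\Delta_\infty(T)=\{F\in H_1^\infty(\mathcal{E},\mathcal{E}') : F(\lambda)=T+D_{T^*}F_0(\lambda)D_T \text{ for all } \lambda\in\mathbb{D}, \text{ for some } F_0\in H_1^\infty(\mathcal{D}_T,\mathcal{D}_{T^*}) \text{ with } \|F_0\|_\infty<1\}.$$ -/

import Mathlib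

noncomputable section

namespace ShmulyanTerHorst

open ContinuousLinearMap
open scoped Complex.UnitDisc ENNReal InnerProductSpace

section Operators

variable {H₁ H₂ : Type*}
  [NormedAddCommGroup H₁] [InnerProductSpace ℂ H₁] [CompleteSpace H₁]
  [NormedAddCommGroup H₂] [InnerProductSpace ℂ H₂] [CompleteSpace H₂]

/-- `T` is a partial isometry: `T T* T = T`. -/
def IsPartialIsometry (T : H₁ →L[ℂ] H₂) : Prop :=
  T ∘L adjoint T ∘L T = T

/-- The defect operator `D_T = (I - T* T)^{1/2}` of a contraction `T`. -/
def defect (T : H₁ →L[ℂ] H₂) : H₁ →L[ℂ] H₁ :=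
  CFC.sqrt (1 - adjoint T ∘L T)

/-- The defect space `𝒟_T`, the closure of the range of `D_T`. -/
abbrev defectSpace (T : H₁ →L[ℂ] H₂) : Submodule ℂ H₁ :=
  (LinearMap.range (defect T).toLinearMap).topologicalClosure

/-- The defect operator `D_T` viewed as an operator from the whole space into `𝒟_T`. -/
def defectInto (T : H₁ →L[ℂ] H₂) : H₁ →L[ℂ] defectSpace T :=
  (defect T).codRestrict (defectSpace T) fun x =>
    Submodule.le_topologicalClosure _ (LinearMap.mem_range_self _ x)

/-- The defect operator `D_T` viewed as an operator from `𝒟_T` into the whole space. -/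
def defectFrom (T : H₁ →L[ℂ] H₂) : defectSpace T →L[ℂ] H₁ :=
  defect T ∘L (defectSpace T).subtypeL

/-- The operator `A + D_{A*} X D_A`, for `X : 𝒟_A → 𝒟_{A*}`. -/
def defectPerturbation (A : H₁ →L[ℂ] H₂)
    (X : defectSpace A →L[ℂ] defectSpace (adjoint A)) : H₁ →L[ℂ] H₂ :=
  A + defectFrom (adjoint A) ∘L X ∘L defectInto A

/-- `B` is Shmul'yan dominated by `A` (for contractions `A`, `B`):
`B = A + D_{A*} X D_A` for some bounded `X : 𝒟_A → 𝒟_{A*}`. -/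
def ShmulyanDominatedBy (B A : H₁ →L[ℂ] H₂) : Prop :=
  ∃ X : defectSpace A →L[ℂ] defectSpace (adjoint A), B = defectPerturbation A X

theorem IsPartialIsometry.norm_le_one {T : H₁ →L[ℂ] H₂} (hT : IsPartialIsometry T) :
    ‖T‖ ≤ 1 := by
  have h1 : ‖adjoint T ∘L T‖ = ‖T‖ * ‖T‖ := norm_adjoint_comp_self T
  have h2 : ‖T‖ ≤ ‖T‖ * (‖T‖ * ‖T‖) := by
    calc ‖T‖ = ‖T ∘L (adjoint T ∘L T)‖ := by rw [hT]
      _ ≤ ‖T‖ * ‖adjoint T ∘L T‖ := opNorm_comp_le _ _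
      _ = _ := by rw [h1]
  have h3 : ‖adjoint T ∘L T‖ = (‖T‖ * ‖T‖) * (‖T‖ * ‖T‖) := by
    have h4 : adjoint (adjoint T ∘L T) ∘L (adjoint T ∘L T) = adjoint T ∘L T := by
      rw [adjoint_comp, adjoint_adjoint, comp_assoc, hT]
    rw [← h1, ← norm_adjoint_comp_self (adjoint T ∘L T), h4]
  rw [h1] at h3
  by_contra hc
  push Not at hc
  nlinarith [mul_pos (sub_pos.2 hc) (sub_pos.2 hc), norm_nonneg T]

end Operators

section Analytic

variable {V W : Type*} [NormedAddCommGroup V] [NormedSpace ℂ V]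
  [NormedAddCommGroup W] [NormedSpace ℂ W]

/-- A function on the open unit disc is analytic if it is the restriction to the disc of a function
that is complex differentiable at the points of the disc. -/
def AnalyticOnDisc (F : 𝔻 → V) : Prop :=
  ∃ f : ℂ → V, DifferentiableOn ℂ f (Metric.ball 0 1) ∧ ∀ z : 𝔻, F z = f z

/-- Membership in `H^∞(V, W)`: norm bounded analytic functions on the disc with values in the
bounded operators from `V` to `W`. -/
def IsHInfinity (F : 𝔻 → (V →L[ℂ] W)) : Prop :=
  AnalyticOnDisc F ∧ BddAbove (Set.range fun z => ‖F z‖)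

/-- The norm `‖F‖_∞` of `H^∞(V, W)`, the supremum of `‖F z‖` over the disc. -/
def hInfinityNorm (F : 𝔻 → (V →L[ℂ] W)) : ℝ :=
  ⨆ z : 𝔻, ‖F z‖

variable (V W) in
/-- The Schur class `H_1^∞(V, W)`, the closed unit ball of `H^∞(V, W)`. -/
def SchurClass : Type _ :=
  {F : 𝔻 → (V →L[ℂ] W) // IsHInfinity F ∧ hInfinityNorm F ≤ 1}

theorem SchurClass.norm_apply_le (F : SchurClass V W) (z : 𝔻) : ‖F.1 z‖ ≤ 1 :=
  (le_ciSup F.2.1.2 z).trans F.2.2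

/-- A contraction viewed as a constant function in the Schur class. -/
def SchurClass.const (T : V →L[ℂ] W) (hT : ‖T‖ ≤ 1) : SchurClass V W :=
  ⟨fun _ => T,
    ⟨⟨fun _ => T, differentiableOn_const _, fun _ => rfl⟩,
      ⟨1, by rintro _ ⟨z, rfl⟩; exact hT⟩⟩,
    ciSup_le fun _ => hT⟩

end Analytic

section Hardy

/-- The Hardy space `H²(E)` of the disc: the function with Taylor coefficients `a₀, a₁, …` is
represented by the square summable sequence of its coefficients, with `‖g‖² = ∑ ‖aₙ‖²`. Its values
on the disc are given by `HardyTwo.eval`. -/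
abbrev HardyTwo (E : Type*) [NormedAddCommGroup E] : Type _ :=
  lp (fun _ : ℕ => E) 2

variable {E E' : Type*} [NormedAddCommGroup E] [InnerProductSpace ℂ E]
  [NormedAddCommGroup E'] [InnerProductSpace ℂ E']

/-- The value `g(z) = ∑ zⁿ aₙ` of a function of the Hardy space at a point of the disc. -/
def HardyTwo.eval (g : HardyTwo E) (z : 𝔻) : E :=
  ∑' n : ℕ, (z : ℂ) ^ n • g n

theorem summable_norm_pow {a : ℕ → E} {C : ℝ} (ha : ∀ n, ‖a n‖ ≤ C) {z : ℂ} (hz : ‖z‖ < 1) :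
    Summable fun n => ‖z ^ n • a n‖ := by
  refine Summable.of_nonneg_of_le (fun _ => norm_nonneg _) (fun n => ?_)
    ((summable_geometric_of_lt_one (norm_nonneg z) hz).mul_right C)
  rw [norm_smul, norm_pow]
  gcongr
  exact ha n

theorem coeff_le {E : Type*} [NormedAddCommGroup E] (g : HardyTwo E) (n : ℕ) : ‖g n‖ ≤ ‖g‖ :=
  lp.norm_apply_le_norm two_ne_zero g n

theorem integral_exp (m : ℤ) :
    ∫ t in (0 : ℝ)..2 * Real.pi, Complex.exp (m * Complex.I * t) =
      if m = 0 then (2 * Real.pi : ℂ) else 0 := by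
  split_ifs with h
  · simp [h]
  · have hc : (m * Complex.I : ℂ) ≠ 0 := by simp [h]
    rw [integral_exp_mul_complex hc]
    have : Complex.exp (m * Complex.I * ((2 * Real.pi : ℝ) : ℂ)) = 1 := by
      rw [Complex.exp_eq_one_iff]
      exact ⟨m, by push_cast; ring⟩
    rw [this]
    simp

/-- Parseval's identity on the circle for absolutely convergent series. -/
theorem parseval [CompleteSpace E] {a : ℕ → E} (ha : Summable fun n => ‖a n‖) :
    HasSum (fun n => 2 * Real.pi * ‖a n‖ ^ 2)
      (∫ t in (0 : ℝ)..2 * Real.pi,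
        ‖∑' n : ℕ, Complex.exp (Complex.I * t) ^ n • a n‖ ^ 2) := by
  set e : ℕ → ℝ → ℂ := fun n t => Complex.exp (Complex.I * t) ^ n with he
  set h : ℝ → E := fun t => ∑' n : ℕ, e n t • a n with hh
  have hen : ∀ n t, ‖e n t‖ = 1 := by
    intro n t
    simp [he, mul_comm Complex.I]
  have hec : ∀ n, Continuous (e n) := fun n => by fun_prop
  have hterm : ∀ n t, ‖e n t • a n‖ = ‖a n‖ := fun n t => by rw [norm_smul, hen, one_mul]
  have hs : ∀ t, HasSum (fun n => e n t • a n) (h t) := fun t =>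
    (Summable.of_norm (by simpa only [hterm] using ha)).hasSum
  have hcont : Continuous h :=
    continuous_tsum (fun n => (hec n).smul continuous_const) ha fun n t => (hterm n t).le
  have hbd : ∀ t, ‖h t‖ ≤ ∑' n, ‖a n‖ := fun t =>
    tsum_of_norm_bounded ha.hasSum fun n => (hterm n t).le
  have hee : ∀ k n t, (starRingEnd ℂ) (e k t) * e n t =
      Complex.exp (((n : ℤ) - (k : ℤ) : ℤ) * Complex.I * t) := by
    intro k n t
    simp only [he, ← Complex.exp_nat_mul, ← Complex.exp_conj, ← Complex.exp_add]
    congr 1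
    simp
    ring
  -- the Fourier coefficients of `h`
  have hfour : ∀ k (y : E), ∫ t in (0 : ℝ)..2 * Real.pi, ⟪e k t • y, h t⟫_ℂ =
      2 * Real.pi * ⟪y, a k⟫_ℂ := by
    intro k y
    have h1 : HasSum (fun n => ∫ t in (0 : ℝ)..2 * Real.pi, ⟪e k t • y, e n t • a n⟫_ℂ)
        (∫ t in (0 : ℝ)..2 * Real.pi, ⟪e k t • y, h t⟫_ℂ) := by
      refine intervalIntegral.hasSum_integral_of_dominated_convergence
        (fun n _ => ‖y‖ * ‖a n‖) (fun n => ?_) (fun n => ?_) ?_ ?_ ?_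
      · exact Continuous.aestronglyMeasurable
          (((hec k).smul continuous_const).inner ((hec n).smul continuous_const))
      · refine Filter.Eventually.of_forall fun t _ => ?_
        refine (norm_inner_le_norm _ _).trans ?_
        rw [hterm, norm_smul, hen, one_mul]
      · exact Filter.Eventually.of_forall fun t _ => ha.mul_left _
      · exact intervalIntegrable_const
      · exact Filter.Eventually.of_forall fun t _ => (hs t).mapL (innerSL ℂ (e k t • y))
    have h2 : ∀ n, ∫ t in (0 : ℝ)..2 * Real.pi, ⟪e k t • y, e n t • a n⟫_ℂ =
        if n = k then 2 * Real.pi * ⟪y, a k⟫_ℂ else 0 := by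
      intro n
      have h3 : ∀ t : ℝ, ⟪e k t • y, e n t • a n⟫_ℂ =
          Complex.exp (((n : ℤ) - (k : ℤ) : ℤ) * Complex.I * t) * ⟪y, a n⟫_ℂ := by
        intro t
        rw [inner_smul_left, inner_smul_right, ← mul_assoc, hee]
      simp only [h3]
      rw [intervalIntegral.integral_mul_const, integral_exp]
      by_cases hnk : n = k
      · subst hnk; simp
      · have : ((n : ℤ) - (k : ℤ)) ≠ 0 := by omega
        simp [hnk, this]
    simp only [h2] at h1
    exact h1.unique (hasSum_ite_eq k _)
  have key : HasSum (fun k => ∫ t in (0 : ℝ)..2 * Real.pi, ⟪e k t • a k, h t⟫_ℂ)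
      (∫ t in (0 : ℝ)..2 * Real.pi, ⟪h t, h t⟫_ℂ) := by
    refine intervalIntegral.hasSum_integral_of_dominated_convergence
      (fun n _ => ‖a n‖ * ∑' n, ‖a n‖) (fun n => ?_) (fun n => ?_) ?_ ?_ ?_
    · exact Continuous.aestronglyMeasurable (((hec n).smul continuous_const).inner hcont)
    · refine Filter.Eventually.of_forall fun t _ => ?_
      refine (norm_inner_le_norm _ _).trans ?_
      rw [hterm]
      gcongr
      exact hbd t
    · exact Filter.Eventually.of_forall fun t _ => ha.mul_right _
    · exact intervalIntegrable_const
    · refine Filter.Eventually.of_forall fun t _ => ?_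
      have h5 := ((hs t).mapL (innerSL ℂ (h t))).star
      simpa [innerSL_apply_apply, mul_comm] using h5
  simp only [hfour] at key
  have h6 : (∫ t in (0 : ℝ)..2 * Real.pi, ⟪h t, h t⟫_ℂ) =
      ((∫ t in (0 : ℝ)..2 * Real.pi, ‖h t‖ ^ 2 : ℝ) : ℂ) := by
    rw [← intervalIntegral.integral_ofReal]
    congr 1
    ext t
    rw [inner_self_eq_norm_sq_to_K]
    push_cast
    rfl
  rw [h6] at key
  have h7 : ∀ k, (2 * Real.pi * ⟪a k, a k⟫_ℂ : ℂ) = ((2 * Real.pi * ‖a k‖ ^ 2 : ℝ) : ℂ) := by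
    intro k
    rw [inner_self_eq_norm_sq_to_K]
    push_cast
    rfl
  simp only [h7] at key
  exact_mod_cast key

/-- If `‖∑ zⁿ bₙ‖ ≤ ‖∑ zⁿ gₙ‖` on the disc, then `∑ ‖bₙ‖² ≤ ∑ ‖gₙ‖²`. -/
theorem sum_coeff_sq_le [CompleteSpace E] [CompleteSpace E'] (g : HardyTwo E) (b : ℕ → E')
    (hb : ∀ z : ℂ, ‖z‖ < 1 → Summable fun n => ‖z ^ n • b n‖)
    (hle : ∀ z : ℂ, ‖z‖ < 1 → ‖∑' n, z ^ n • b n‖ ≤ ‖∑' n, z ^ n • g n‖) (s : Finset ℕ) :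
    ∑ n ∈ s, ‖b n‖ ^ 2 ≤ ‖g‖ ^ 2 := by
  have hg2 : HasSum (fun n => ‖g n‖ ^ 2) (‖g‖ ^ 2) := by
    have h := lp.hasSum_norm (p := 2) (by norm_num) g
    simpa using h
  have hr : ∀ r : ℝ, 0 < r → r < 1 → ∑ n ∈ s, ‖((r : ℂ) ^ n) • b n‖ ^ 2 ≤ ‖g‖ ^ 2 := by
    intro r hr0 hr1
    have hrn : ‖(r : ℂ)‖ < 1 := by simpa [abs_of_pos hr0] using hr1
    have hgs := summable_norm_pow (coeff_le g) hrn
    have pb := parseval (hb r hrn)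
    have pg := parseval hgs
    have hz : ∀ t : ℝ, ‖Complex.exp (Complex.I * t) * r‖ < 1 := by
      intro t
      rw [norm_mul, mul_comm Complex.I, Complex.norm_exp_ofReal_mul_I, one_mul]
      exact hrn
    have hsm : ∀ (t : ℝ) (n : ℕ) (x : E),
        Complex.exp (Complex.I * t) ^ n • ((r : ℂ) ^ n • x) =
          (Complex.exp (Complex.I * t) * r) ^ n • x := by
      intro t n x
      rw [smul_smul, mul_pow]
    have hsm' : ∀ (t : ℝ) (n : ℕ) (x : E'),
        Complex.exp (Complex.I * t) ^ n • ((r : ℂ) ^ n • x) =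
          (Complex.exp (Complex.I * t) * r) ^ n • x := by
      intro t n x
      rw [smul_smul, mul_pow]
    have hcb : Continuous fun t : ℝ =>
        ∑' n : ℕ, Complex.exp (Complex.I * t) ^ n • ((r : ℂ) ^ n • b n) := by
      refine continuous_tsum (fun n => by fun_prop) (hb r hrn) fun n t => ?_
      rw [norm_smul, norm_pow, mul_comm Complex.I, Complex.norm_exp_ofReal_mul_I, one_pow, one_mul]
    have hcg : Continuous fun t : ℝ =>
        ∑' n : ℕ, Complex.exp (Complex.I * t) ^ n • ((r : ℂ) ^ n • g n) := by
      refine continuous_tsum (fun n => by fun_prop) hgs fun n t => ?_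
      rw [norm_smul, norm_pow, mul_comm Complex.I, Complex.norm_exp_ofReal_mul_I, one_pow, one_mul]
    have hint : (∫ t in (0 : ℝ)..2 * Real.pi,
          ‖∑' n : ℕ, Complex.exp (Complex.I * t) ^ n • ((r : ℂ) ^ n • b n)‖ ^ 2) ≤
        ∫ t in (0 : ℝ)..2 * Real.pi,
          ‖∑' n : ℕ, Complex.exp (Complex.I * t) ^ n • ((r : ℂ) ^ n • g n)‖ ^ 2 := by
      refine intervalIntegral.integral_mono_on Real.two_pi_pos.le
        ((hcb.norm.pow 2).intervalIntegrable _ _) ((hcg.norm.pow 2).intervalIntegrable _ _)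
        fun t _ => ?_
      simp only [hsm, hsm']
      gcongr
      exact hle _ (hz t)
    have h1 : ∑ n ∈ s, 2 * Real.pi * ‖((r : ℂ) ^ n) • b n‖ ^ 2 ≤ 2 * Real.pi * ‖g‖ ^ 2 := by
      refine (sum_le_hasSum s (fun n _ => by positivity) pb).trans (hint.trans ?_)
      refine hasSum_le (fun n => ?_) pg (hg2.mul_left (2 * Real.pi))
      have : ‖(r : ℂ) ^ n • g n‖ ≤ ‖g n‖ := by
        rw [norm_smul, norm_pow]
        exact mul_le_of_le_one_left (norm_nonneg _) (pow_le_one₀ (norm_nonneg _) hrn.le)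
      gcongr
    rw [← Finset.mul_sum] at h1
    exact le_of_mul_le_mul_left h1 Real.two_pi_pos
  have hlim : Filter.Tendsto (fun r : ℝ => ∑ n ∈ s, ‖((r : ℂ) ^ n) • b n‖ ^ 2)
      (nhdsWithin 1 (Set.Iio 1)) (nhds (∑ n ∈ s, ‖b n‖ ^ 2)) := by
    have hc : Continuous fun r : ℝ => ∑ n ∈ s, ‖((r : ℂ) ^ n) • b n‖ ^ 2 := by fun_prop
    have := hc.tendsto 1
    simp only [Complex.ofReal_one, one_pow, one_smul] at this
    exact this.mono_left nhdsWithin_le_nhds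
  refine le_of_tendsto hlim ?_
  filter_upwards [Ioo_mem_nhdsLT (show (0 : ℝ) < 1 by norm_num)] with r hr'
  exact hr r hr'.1 hr'.2

/-- The values on the disc determine a function of the Hardy space. -/
theorem HardyTwo.eval_injective [CompleteSpace E] {g h : HardyTwo E}
    (H : ∀ z, g.eval z = h.eval z) : g = h := by
  have hz : ∀ z : ℂ, ‖z‖ < 1 → ∑' n, z ^ n • (g - h) n = 0 := by
    intro z hz
    have h1 := (summable_norm_pow (coeff_le g) hz).of_norm
    have h2 := (summable_norm_pow (coeff_le h) hz).of_norm
    have h3 : g.eval (.mk z hz) = h.eval (.mk z hz) := H _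
    simp only [HardyTwo.eval, Complex.UnitDisc.coe_mk] at h3
    have h4 : ∀ n, z ^ n • (g - h) n = z ^ n • g n - z ^ n • h n := fun n => by
      rw [lp.coeFn_sub, Pi.sub_apply, smul_sub]
    simp only [h4]
    rw [h1.tsum_sub h2, h3, sub_self]
  have key : ∀ n, (g - h) n = 0 := by
    intro n
    have := sum_coeff_sq_le (0 : HardyTwo E) (fun n => (g - h) n)
      (fun z hz => summable_norm_pow (coeff_le (g - h)) hz)
      (fun z hz' => by rw [hz z hz']; simp) {n}
    simpa using this
  rw [← sub_eq_zero]
  ext n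
  exact key n

theorem hardy_differentiableOn [CompleteSpace E] (g : HardyTwo E) :
    DifferentiableOn ℂ (fun z : ℂ => ∑' n, z ^ n • g n) (Metric.ball 0 1) := by
  intro z hz
  obtain ⟨r, hzr, hr1⟩ := exists_between (mem_ball_zero_iff.1 hz)
  have hr0 : 0 ≤ r := (norm_nonneg z).trans hzr.le
  have hd : DifferentiableOn ℂ (fun z : ℂ => ∑' n, z ^ n • g n) (Metric.ball 0 r) := by
    refine Complex.differentiableOn_tsum_of_summable_norm (u := fun n => r ^ n * ‖g‖)
      ((summable_geometric_of_lt_one hr0 hr1).mul_right _)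
      (fun n => (DifferentiableOn.pow differentiableOn_id n).smul_const _) Metric.isOpen_ball
      fun n w hw => ?_
    rw [norm_smul, norm_pow]
    have hw' := mem_ball_zero_iff.1 hw
    gcongr
    exact coeff_le g n
  exact (hd.differentiableAt (Metric.isOpen_ball.mem_nhds
    (mem_ball_zero_iff.2 hzr))).differentiableWithinAt

theorem exists_taylor_coeff [CompleteSpace E] {f : ℂ → E}
    (hf : DifferentiableOn ℂ f (Metric.ball 0 1)) :
    ∃ c : ℕ → E, ∀ z : ℂ, ‖z‖ < 1 →
      (Summable fun n => ‖z ^ n • c n‖) ∧ ∑' n, z ^ n • c n = f z := by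
  set c : ℕ → E := fun n => ((n.factorial : ℂ))⁻¹ • iteratedDeriv n f 0 with hc
  have hsum : ∀ z : ℂ, ‖z‖ < 1 → HasSum (fun n => z ^ n • c n) (f z) := by
    intro z hz
    have h := Complex.hasSum_taylorSeries_on_ball hf (mem_ball_zero_iff.2 hz)
    simp only [sub_zero] at h
    convert h using 2 with n
    rw [hc, smul_comm]
  refine ⟨c, fun z hz => ⟨?_, (hsum z hz).tsum_eq⟩⟩
  obtain ⟨r, hzr, hr1⟩ := exists_between hz
  have hr0 : 0 < r := (norm_nonneg z).trans_lt hzr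
  have hrn : ‖(r : ℂ)‖ < 1 := by simpa [abs_of_pos hr0] using hr1
  obtain ⟨C, hC⟩ := (hsum r hrn).summable.tendsto_atTop_zero.norm.bddAbove_range
  have hq : ‖z / r‖ < 1 := by
    rw [norm_div, Complex.norm_real, Real.norm_of_nonneg hr0.le]
    exact (div_lt_one hr0).2 hzr
  have h := summable_norm_pow (a := fun n => (r : ℂ) ^ n • c n) (fun n => hC ⟨n, rfl⟩) hq
  refine h.congr fun n => ?_
  rw [smul_smul, ← mul_pow, div_mul_cancel₀]
  exact_mod_cast hr0.ne'

/-- Multiplication by a function of the Schur class maps `H²(E)` contractively into `H²(E')`. -/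
theorem exists_mul [CompleteSpace E] [CompleteSpace E'] (F : SchurClass E E') (g : HardyTwo E) :
    ∃ h : HardyTwo E', (∀ z, h.eval z = F.1 z (g.eval z)) ∧ ‖h‖ ≤ ‖g‖ := by
  obtain ⟨f, hf, hFf⟩ := F.2.1.1
  obtain ⟨c, hc⟩ := exists_taylor_coeff (hf.clm_apply (hardy_differentiableOn g))
  have hs := sum_coeff_sq_le g c (fun z hz => (hc z hz).1) fun z hz => by
    rw [(hc z hz).2]
    refine le_of_opNorm_le_of_le _ ?_ le_rfl |>.trans_eq (one_mul _)
    have := F.norm_apply_le (.mk z hz)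
    rwa [hFf, Complex.UnitDisc.coe_mk] at this
  have hmem : Memℓp c 2 := memℓp_gen' (C := ‖g‖ ^ 2) fun s => by simpa using hs s
  refine ⟨⟨c, hmem⟩, fun z => ?_, ?_⟩
  · rw [hFf]
    exact (hc z z.norm_lt_one).2
  · refine lp.norm_le_of_forall_sum_le (by norm_num) (norm_nonneg g) fun s => ?_
    simpa using hs s

theorem HardyTwo.eval_add [CompleteSpace E] (g h : HardyTwo E) (z : 𝔻) :
    (g + h).eval z = g.eval z + h.eval z := by
  simp only [HardyTwo.eval, lp.coeFn_add, Pi.add_apply, smul_add]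
  exact (summable_norm_pow (coeff_le g) z.norm_lt_one).of_norm.tsum_add
    (summable_norm_pow (coeff_le h) z.norm_lt_one).of_norm

theorem HardyTwo.eval_smul [CompleteSpace E] (c : ℂ) (g : HardyTwo E) (z : 𝔻) :
    (c • g).eval z = c • g.eval z := by
  simp only [HardyTwo.eval, lp.coeFn_smul, Pi.smul_apply, smul_comm _ c]
  exact (summable_norm_pow (coeff_le g) z.norm_lt_one).of_norm.tsum_const_smul c

/-- The Toeplitz operator `T_F : H²(E) → H²(E')` of a function `F` of the Schur class, which is
multiplication by `F`: `(T_F g)(z) = F(z) g(z)`. -/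
def toeplitz [CompleteSpace E] [CompleteSpace E'] (F : SchurClass E E') :
    HardyTwo E →L[ℂ] HardyTwo E' :=
  LinearMap.mkContinuous
    { toFun := fun g => (exists_mul F g).choose
      map_add' := fun g h => HardyTwo.eval_injective fun z => by
        rw [HardyTwo.eval_add, (exists_mul F _).choose_spec.1, (exists_mul F _).choose_spec.1,
          (exists_mul F _).choose_spec.1, HardyTwo.eval_add, map_add]
      map_smul' := fun c g => HardyTwo.eval_injective fun z => by
        rw [RingHom.id_apply, HardyTwo.eval_smul, (exists_mul F _).choose_spec.1,
          (exists_mul F _).choose_spec.1, HardyTwo.eval_smul, map_smul] }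
    1 fun g => by
      rw [one_mul]
      exact (exists_mul F g).choose_spec.2

/-- The defining property of the Toeplitz operator. -/
theorem toeplitz_eval [CompleteSpace E] [CompleteSpace E'] (F : SchurClass E E')
    (g : HardyTwo E) (z : 𝔻) : (toeplitz F g).eval z = F.1 z (g.eval z) :=
  (exists_mul F g).choose_spec.1 z

theorem norm_toeplitz_le [CompleteSpace E] [CompleteSpace E'] (F : SchurClass E E') :
    ‖toeplitz F‖ ≤ 1 :=
  LinearMap.mkContinuous_norm_le _ zero_le_one _

/-- `F` is Shmul'yan-ter Horst dominated by `G`: the Toeplitz operator `T_F` is Shmul'yan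
dominated by `T_G`. -/
def DominatedBy [CompleteSpace E] [CompleteSpace E'] (F G : SchurClass E E') : Prop :=
  ShmulyanDominatedBy (toeplitz F) (toeplitz G)

/-- The Shmul'yan-ter Horst equivalence class `Δ_∞(F)` in the Schur class. -/
def equivalenceClass [CompleteSpace E] [CompleteSpace E'] (F : SchurClass E E') :
    Set (SchurClass E E') :=
  {G | DominatedBy G F ∧ DominatedBy F G}

end Hardy

end ShmulyanTerHorst

end

/-!
Call operators `T` and `C` *-orthogonal if `T* C = 0` and `C T* = 0`. The defect operators of a
partial isometry `T` are the projections onto its kernel and cokernel, so `B` is dominated by `T`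
exactly when `B = T + C` with `C` *-orthogonal to `T`. In that case
`1 - B* B = (1 - C* C)(1 - T* T)`, and similarly for `B B*`; if `‖C‖ < 1` the factors coming from
`C` are invertible, which makes `T` dominated by `B`. Conversely, if `T = B + D_{B*} X D_B`, then
`‖B x‖ ≤ ‖X‖ ‖D_B x‖` on the kernel of `T`, and `‖D_B x‖² = ‖x‖² - ‖B x‖²` forces `‖C‖ < 1`.

These conditions pass from operators on Hardy spaces to their symbols, because an operator is
determined by its symbol and its norm is the supremum of the norms of the symbol. The latter follows
from the Szegő kernel: `Φ(z)` is the compression `(1 - |z|²) e_z M e_z*` of the operator `M` with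
symbol `Φ`, where the evaluation `e_z` satisfies `e_z e_z* = (1 - |z|²)⁻¹`.
-/

namespace ShmulyanTerHorst

open ContinuousLinearMap
open scoped Complex.UnitDisc ComplexConjugate InnerProductSpace InnerProduct

section Operators

variable {H₁ H₂ : Type*}
  [NormedAddCommGroup H₁] [InnerProductSpace ℂ H₁] [CompleteSpace H₁]
  [NormedAddCommGroup H₂] [InnerProductSpace ℂ H₂] [CompleteSpace H₂]
  {A B C T : H₁ →L[ℂ] H₂}

/-! ### Defect operators of contractions -/

theorem norm_adjoint_le_one (hA : ‖A‖ ≤ 1) : ‖A†‖ ≤ 1 := by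
  rwa [LinearIsometryEquiv.norm_map]

theorem one_sub_adjoint_comp_self_nonneg (hA : ‖A‖ ≤ 1) : 0 ≤ 1 - A† ∘L A := by
  have hpos : 0 ≤ A† ∘L A := (nonneg_iff_isPositive _).2 (isPositive_adjoint_comp_self A)
  rw [sub_nonneg, ← CStarAlgebra.norm_le_one_iff_of_nonneg _ hpos, norm_adjoint_comp_self]
  exact mul_le_one₀ hA (norm_nonneg A) hA

theorem isUnit_one_sub_adjoint_comp_self (hA : ‖A‖ < 1) : IsUnit (1 - A† ∘L A) := by
  have hlt : ‖A† ∘L A‖ < 1 := by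
    rw [norm_adjoint_comp_self]
    exact mul_lt_one_of_nonneg_of_lt_one_left (norm_nonneg A) hA hA.le
  exact isUnit_one_sub_of_norm_lt_one hlt

theorem defect_comp_defect (hA : ‖A‖ ≤ 1) : defect A ∘L defect A = 1 - A† ∘L A :=
  CFC.sqrt_mul_sqrt_self _ (one_sub_adjoint_comp_self_nonneg hA)

theorem adjoint_defect (A : H₁ →L[ℂ] H₂) : (defect A)† = defect A :=
  (IsSelfAdjoint.of_nonneg (CFC.sqrt_nonneg (1 - A† ∘L A))).adjoint_eq

theorem norm_defect_apply_sq (hA : ‖A‖ ≤ 1) (x : H₁) :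
    ‖defect A x‖ ^ 2 = ‖x‖ ^ 2 - ‖A x‖ ^ 2 := by
  have hinner : ⟪defect A x, defect A x⟫_ℂ = ⟪x, x⟫_ℂ - ⟪A x, A x⟫_ℂ := by
    rw [← adjoint_inner_right, adjoint_defect, ← comp_apply, defect_comp_defect hA, sub_apply,
      one_apply_eq_self, comp_apply, inner_sub_right, adjoint_inner_right]
  simp only [inner_self_eq_norm_sq_to_K] at hinner
  exact_mod_cast hinner

theorem norm_defect_apply_le (hA : ‖A‖ ≤ 1) (x : H₁) : ‖defect A x‖ ≤ ‖x‖ := by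
  refine le_of_sq_le_sq ?_ (norm_nonneg x)
  rw [norm_defect_apply_sq hA]
  exact sub_le_self _ (sq_nonneg _)

theorem norm_defectInto_le_one (hA : ‖A‖ ≤ 1) : ‖defectInto A‖ ≤ 1 :=
  opNorm_le_bound _ zero_le_one fun x => by
    rw [one_mul]
    exact norm_defect_apply_le hA x

theorem norm_defectFrom_le_one (hA : ‖A‖ ≤ 1) : ‖defectFrom A‖ ≤ 1 :=
  opNorm_le_bound _ zero_le_one fun x => by
    rw [one_mul]
    exact norm_defect_apply_le hA x

theorem norm_comp_comp_le {V₁ V₂ V₃ V₄ : Type*}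
    [SeminormedAddCommGroup V₁] [SeminormedAddCommGroup V₂] [SeminormedAddCommGroup V₃]
    [SeminormedAddCommGroup V₄] [NormedSpace ℂ V₁] [NormedSpace ℂ V₂] [NormedSpace ℂ V₃]
    [NormedSpace ℂ V₄] (R : V₃ →L[ℂ] V₄) (S : V₂ →L[ℂ] V₃) (P : V₁ →L[ℂ] V₂) :
    ‖R ∘L S ∘L P‖ ≤ ‖R‖ * ‖S‖ * ‖P‖ := by
  rw [← comp_assoc]
  exact (opNorm_comp_le _ _).trans (by gcongr; exact opNorm_comp_le _ _)

theorem norm_comp_comp_le_of_norm_le_one {V₁ V₂ V₃ V₄ : Type*}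
    [SeminormedAddCommGroup V₁] [SeminormedAddCommGroup V₂] [SeminormedAddCommGroup V₃]
    [SeminormedAddCommGroup V₄] [NormedSpace ℂ V₁] [NormedSpace ℂ V₂] [NormedSpace ℂ V₃]
    [NormedSpace ℂ V₄] {R : V₃ →L[ℂ] V₄} {P : V₁ →L[ℂ] V₂} (hR : ‖R‖ ≤ 1) (hP : ‖P‖ ≤ 1)
    (S : V₂ →L[ℂ] V₃) : ‖R ∘L S ∘L P‖ ≤ ‖S‖ :=
  calc ‖R ∘L S ∘L P‖ ≤ ‖R‖ * ‖S‖ * ‖P‖ := norm_comp_comp_le R S P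
    _ ≤ 1 * ‖S‖ * 1 := by gcongr
    _ = ‖S‖ := by ring

/-- The compression `D_{A*} C D_A` of an operator `C`, as an operator between the defect spaces
of `A`. -/
noncomputable def defectCompression (A C : H₁ →L[ℂ] H₂) :
    defectSpace A →L[ℂ] defectSpace (A†) :=
  defectInto (A†) ∘L C ∘L defectFrom A

theorem norm_defectCompression_le (hA : ‖A‖ ≤ 1) (C : H₁ →L[ℂ] H₂) :
    ‖defectCompression A C‖ ≤ ‖C‖ :=
  norm_comp_comp_le_of_norm_le_one (norm_defectInto_le_one (norm_adjoint_le_one hA))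
    (norm_defectFrom_le_one hA) C

theorem norm_defectPerturbation_sub_le (hA : ‖A‖ ≤ 1)
    (X : defectSpace A →L[ℂ] defectSpace (A†)) : ‖defectPerturbation A X - A‖ ≤ ‖X‖ := by
  rw [defectPerturbation, add_sub_cancel_left]
  exact norm_comp_comp_le_of_norm_le_one (norm_defectFrom_le_one (norm_adjoint_le_one hA))
    (norm_defectInto_le_one hA) X

theorem defectPerturbation_defectCompression (hA : ‖A‖ ≤ 1) (C : H₁ →L[ℂ] H₂) :
    defectPerturbation A (defectCompression A C) =
      A + (1 - A ∘L A†) ∘L C ∘L (1 - A† ∘L A) := by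
  have hadj := defect_comp_defect (norm_adjoint_le_one hA)
  rw [adjoint_adjoint] at hadj
  rw [← hadj, ← defect_comp_defect hA]
  rfl

theorem shmulyanDominatedBy_of_eq_add (hA : ‖A‖ ≤ 1)
    (hB : B = A + (1 - A ∘L A†) ∘L C ∘L (1 - A† ∘L A)) : ShmulyanDominatedBy B A :=
  ⟨defectCompression A C, hB.trans (defectPerturbation_defectCompression hA C).symm⟩

theorem ShmulyanDominatedBy.exists_norm_apply_le (h : ShmulyanDominatedBy T A) (hA : ‖A‖ ≤ 1) :
    ∃ c : ℝ, 0 ≤ c ∧ c < 1 ∧ ∀ x, T x = 0 → ‖A x‖ ≤ c * ‖x‖ := by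
  obtain ⟨X, hX⟩ := h
  set m := ‖defectFrom (A†) ∘L X‖
  have hpos : 0 < 1 + m ^ 2 := by positivity
  refine ⟨√(m ^ 2 / (1 + m ^ 2)), Real.sqrt_nonneg _, ?_, fun x hx => ?_⟩
  · rw [Real.sqrt_lt' one_pos, div_lt_iff₀ hpos]
    linarith
  have hAx : A x = -(defectFrom (A†) ∘L X) (defectInto A x) := by
    rw [hX] at hx
    exact eq_neg_of_add_eq_zero_left hx
  have hle : ‖A x‖ ≤ m * ‖defect A x‖ := by
    rw [hAx, norm_neg]
    exact le_opNorm _ _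
  have hsq : ‖A x‖ ^ 2 ≤ m ^ 2 * (‖x‖ ^ 2 - ‖A x‖ ^ 2) := by
    rw [← norm_defect_apply_sq hA, ← mul_pow]
    gcongr
  refine le_of_sq_le_sq ?_ (by positivity)
  rw [mul_pow, Real.sq_sqrt (by positivity), div_mul_eq_mul_div, le_div_iff₀ hpos]
  linarith

/-! ### *-orthogonal operators -/

/-- The operators `T` and `C` are *-orthogonal: they have orthogonal ranges and orthogonal initial
spaces. The second condition is stated as `C T* = 0`, the adjoint of `T C* = 0`. -/
def IsStarOrthogonal (T C : H₁ →L[ℂ] H₂) : Prop :=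
  T† ∘L C = 0 ∧ C ∘L T† = 0

namespace IsStarOrthogonal

protected theorem symm (h : IsStarOrthogonal T C) : IsStarOrthogonal C T := by
  constructor
  · simpa [adjoint_comp] using congrArg adjoint h.1
  · simpa [adjoint_comp] using congrArg adjoint h.2

protected theorem adjoint (h : IsStarOrthogonal T C) : IsStarOrthogonal (T†) (C†) := by
  rw [IsStarOrthogonal, adjoint_adjoint]
  exact ⟨h.symm.2, h.symm.1⟩

theorem one_sub_adjoint_comp_self_add (h : IsStarOrthogonal T C) :
    1 - (T + C)† ∘L (T + C) = (1 - C† ∘L C) ∘L (1 - T† ∘L T) := by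
  have hcross : (C† ∘L C) ∘L (T† ∘L T) = 0 := by
    rw [comp_assoc, ← comp_assoc C, h.2, zero_comp, comp_zero]
  simp only [map_add, add_comp, comp_add, sub_comp, comp_sub, h.1, h.symm.1, hcross, one_def,
    id_comp, comp_id]
  abel

theorem one_sub_comp_adjoint_self_add (h : IsStarOrthogonal T C) :
    1 - (T + C) ∘L (T + C)† = (1 - T ∘L T†) ∘L (1 - C ∘L C†) := by
  have hdual := h.symm.adjoint.one_sub_adjoint_comp_self_add
  simpa only [← map_add, adjoint_adjoint, add_comm C] using hdual

theorem one_sub_comp_comp_one_sub (h : IsStarOrthogonal T C) :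
    (1 - T ∘L T†) ∘L C ∘L (1 - T† ∘L T) = C := by
  have hright : C ∘L (1 - T† ∘L T) = C := by
    rw [comp_sub, ← comp_assoc, h.2, zero_comp, sub_zero, one_def, comp_id]
  rw [hright, sub_comp, comp_assoc, h.1, comp_zero, sub_zero, one_def, id_comp]

theorem shmulyanDominatedBy_add (h : IsStarOrthogonal T C) (hTC : ‖T + C‖ ≤ 1) (hC : ‖C‖ < 1) :
    ShmulyanDominatedBy T (T + C) := by
  obtain ⟨M, hM⟩ : ∃ M, M ∘L (1 - C† ∘L C) = 1 :=
    (isUnit_one_sub_adjoint_comp_self hC).exists_left_inv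
  obtain ⟨N, hN⟩ : ∃ N, (1 - C ∘L C†) ∘L N = 1 := by
    have hunit : IsUnit (1 - C†† ∘L C†) :=
      isUnit_one_sub_adjoint_comp_self (by rwa [LinearIsometryEquiv.norm_map])
    rw [adjoint_adjoint] at hunit
    exact hunit.exists_right_inv
  refine shmulyanDominatedBy_of_eq_add (C := -(N ∘L C ∘L M)) hTC ?_
  symm
  calc T + C + (1 - (T + C) ∘L (T + C)†) ∘L (-(N ∘L C ∘L M)) ∘L (1 - (T + C)† ∘L (T + C))
      = T + C - (1 - T ∘L T†) ∘L ((1 - C ∘L C†) ∘L N) ∘L C ∘L (M ∘L (1 - C† ∘L C)) ∘L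
          (1 - T† ∘L T) := by
        rw [h.one_sub_adjoint_comp_self_add, h.one_sub_comp_adjoint_self_add]
        simp only [neg_comp, comp_neg, comp_assoc, sub_eq_add_neg]
    _ = T + C - (1 - T ∘L T†) ∘L C ∘L (1 - T† ∘L T) := by
        rw [hM, hN, one_def, one_def, id_comp, id_comp]
    _ = T := by rw [h.one_sub_comp_comp_one_sub, add_sub_cancel_right]

end IsStarOrthogonal

/-! ### Partial isometries -/

namespace IsPartialIsometry

protected theorem adjoint (hT : IsPartialIsometry T) : IsPartialIsometry (T†) := by
  have h := congrArg adjoint hT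
  rwa [adjoint_comp, adjoint_comp, comp_assoc] at h

theorem defect_eq (hT : IsPartialIsometry T) : defect T = 1 - T† ∘L T := by
  refine CFC.sqrt_unique ?_ (one_sub_adjoint_comp_self_nonneg hT.norm_le_one)
  have hproj : (T† ∘L T) * (T† ∘L T) = T† ∘L T := congrArg (T† ∘L ·) hT
  rw [mul_sub, mul_one, sub_mul, one_mul, hproj, sub_self, sub_zero]

theorem comp_defect (hT : IsPartialIsometry T) : T ∘L defect T = 0 := by
  rw [hT.defect_eq, comp_sub, hT, one_def, comp_id, sub_self]

theorem defect_comp_adjoint (hT : IsPartialIsometry T) : defect T ∘L T† = 0 := by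
  simpa [adjoint_comp, adjoint_defect] using congrArg adjoint hT.comp_defect

theorem isStarOrthogonal_defectPerturbation_sub (hT : IsPartialIsometry T)
    (X : defectSpace T →L[ℂ] defectSpace (T†)) :
    IsStarOrthogonal T (defectPerturbation T X - T) := by
  have hinto : defectInto T ∘L T† = 0 := by
    ext y
    exact DFunLike.congr_fun hT.defect_comp_adjoint y
  have hfrom : T† ∘L defectFrom (T†) = 0 := by
    rw [defectFrom, ← comp_assoc, hT.adjoint.comp_defect, zero_comp]
  rw [defectPerturbation, add_sub_cancel_left]
  constructor
  · rw [← comp_assoc, hfrom, zero_comp]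
  · rw [comp_assoc, comp_assoc, hinto, comp_zero, comp_zero]

theorem defectPerturbation_defectCompression_sub (hT : IsPartialIsometry T)
    (h : IsStarOrthogonal T (B - T)) :
    defectPerturbation T (defectCompression T (B - T)) = B := by
  rw [defectPerturbation_defectCompression hT.norm_le_one, h.one_sub_comp_comp_one_sub,
    add_sub_cancel]

theorem shmulyanDominatedBy_iff (hT : IsPartialIsometry T) :
    ShmulyanDominatedBy B T ↔ IsStarOrthogonal T (B - T) := by
  constructor
  · rintro ⟨X, rfl⟩
    exact hT.isStarOrthogonal_defectPerturbation_sub X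
  · exact fun h => ⟨_, (hT.defectPerturbation_defectCompression_sub h).symm⟩

theorem norm_sub_lt_one (hT : IsPartialIsometry T) (h : IsStarOrthogonal T (A - T))
    (hA : ‖A‖ ≤ 1) (hTA : ShmulyanDominatedBy T A) : ‖A - T‖ < 1 := by
  obtain ⟨c, hc0, hc1, hc⟩ := hTA.exists_norm_apply_le hA
  refine (opNorm_le_bound _ hc0 fun x => ?_).trans_lt hc1
  have hker : T (defect T x) = 0 := DFunLike.congr_fun hT.comp_defect x
  have hfactor : A - T = (A - T) ∘L defect T := by
    rw [hT.defect_eq, comp_sub, ← comp_assoc, h.2, zero_comp, sub_zero, one_def, comp_id]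
  calc ‖(A - T) x‖ = ‖A (defect T x)‖ := by
        rw [hfactor, comp_apply, sub_apply, hker, sub_zero]
    _ ≤ c * ‖defect T x‖ := hc _ hker
    _ ≤ c * ‖x‖ := by gcongr; exact norm_defect_apply_le hT.norm_le_one x

theorem shmulyanDominatedBy_and_symm_iff (hT : IsPartialIsometry T) (hA : ‖A‖ ≤ 1) :
    ShmulyanDominatedBy A T ∧ ShmulyanDominatedBy T A ↔
      IsStarOrthogonal T (A - T) ∧ ‖A - T‖ < 1 := by
  rw [hT.shmulyanDominatedBy_iff]
  refine and_congr_right fun h => ⟨hT.norm_sub_lt_one h hA, fun hlt => ?_⟩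
  have hdom := h.shmulyanDominatedBy_add (by rwa [add_sub_cancel]) hlt
  rwa [add_sub_cancel] at hdom

end IsPartialIsometry

end Operators

section Hardy

variable {E E' G : Type*} [NormedAddCommGroup E] [InnerProductSpace ℂ E]
  [NormedAddCommGroup E'] [InnerProductSpace ℂ E'] [NormedAddCommGroup G] [InnerProductSpace ℂ G]

/-! ### Evaluation on Hardy spaces and the Szegő kernel -/

theorem HardyTwo.eval_zero (z : 𝔻) : (0 : HardyTwo E).eval z = 0 := by
  simp [HardyTwo.eval]

theorem HardyTwo.eval_single (n : ℕ) (x : E) (z : 𝔻) :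
    HardyTwo.eval (lp.single 2 n x : HardyTwo E) z = (z : ℂ) ^ n • x := by
  rw [HardyTwo.eval, tsum_eq_single n fun k hk => by rw [lp.single_apply_ne _ _ _ hk, smul_zero],
    lp.single_apply_self]

theorem HardyTwo.norm_eval_le (g : HardyTwo E) (z : 𝔻) :
    ‖g.eval z‖ ≤ (1 - ‖(z : ℂ)‖)⁻¹ * ‖g‖ := by
  refine tsum_of_norm_bounded
    ((hasSum_geometric_of_lt_one (norm_nonneg _) z.norm_lt_one).mul_right ‖g‖) fun n => ?_
  rw [norm_smul, norm_pow]
  gcongr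
  exact coeff_le g n

section Evaluation

variable [CompleteSpace E]

theorem HardyTwo.eval_sub (g h : HardyTwo E) (z : 𝔻) :
    (g - h).eval z = g.eval z - h.eval z := by
  rw [eq_sub_iff_add_eq, ← HardyTwo.eval_add, sub_add_cancel]

variable (E) in
/-- The evaluation `g ↦ g(z)` as a bounded operator from `H²(E)` to `E`. Its adjoint sends `y` to
the Szegő kernel function `w ↦ (1 - w conj(z))⁻¹ y`. -/
noncomputable def evalCLM (z : 𝔻) : HardyTwo E →L[ℂ] E :=
  LinearMap.mkContinuous
    { toFun := fun g => g.eval z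
      map_add' := fun g h => g.eval_add h z
      map_smul' := fun c g => HardyTwo.eval_smul c g z }
    (1 - ‖(z : ℂ)‖)⁻¹ fun g => g.norm_eval_le z

theorem evalCLM_apply (z : 𝔻) (g : HardyTwo E) : evalCLM E z g = g.eval z :=
  rfl

theorem adjoint_evalCLM_apply_coeff (z : 𝔻) (y : E) (n : ℕ) :
    (((evalCLM E z)†) y) n = conj (z : ℂ) ^ n • y := by
  refine ext_inner_left ℂ fun x : E => ?_
  have hcoeff : ⟪x, (((evalCLM E z)†) y) n⟫_ℂ =
      ⟪(lp.single 2 n x : HardyTwo E), ((evalCLM E z)†) y⟫_ℂ :=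
    (lp.inner_single_left (𝕜 := ℂ) (G := fun _ : ℕ => E) n x _).symm
  rw [hcoeff, adjoint_inner_right, evalCLM_apply, HardyTwo.eval_single,
    inner_smul_left, inner_smul_right, map_pow]

theorem norm_mul_conj_lt_one (w z : 𝔻) : ‖(w : ℂ) * conj (z : ℂ)‖ < 1 := by
  rw [norm_mul, RCLike.norm_conj]
  exact mul_lt_one_of_nonneg_of_lt_one_left (norm_nonneg _) w.norm_lt_one z.norm_lt_one.le

theorem evalCLM_comp_adjoint_evalCLM (w z : 𝔻) :
    evalCLM E w ∘L (evalCLM E z)† = (1 - (w : ℂ) * conj (z : ℂ))⁻¹ • 1 := by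
  ext y
  have hsum :=
    ((hasSum_geometric_of_norm_lt_one (norm_mul_conj_lt_one w z)).smul_const y).tsum_eq
  simpa only [comp_apply, evalCLM_apply, HardyTwo.eval, adjoint_evalCLM_apply_coeff, smul_smul,
    ← mul_pow, smul_apply, one_apply_eq_self] using hsum

theorem norm_evalCLM_le (z : 𝔻) : ‖evalCLM E z‖ ≤ √‖1 - (z : ℂ) * conj (z : ℂ)‖⁻¹ := by
  have hnorm := norm_adjoint_comp_self ((evalCLM E z)†)
  rw [adjoint_adjoint, LinearIsometryEquiv.norm_map, evalCLM_comp_adjoint_evalCLM, norm_smul,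
    norm_inv] at hnorm
  refine Real.le_sqrt_of_sq_le ?_
  rw [sq, ← hnorm]
  exact mul_le_of_le_one_right (by positivity) norm_id_le

end Evaluation

/-! ### Operators with a symbol -/

/-- The operator `M` on Hardy spaces is multiplication by the function `Φ`, its symbol:
`(M g)(z) = Φ(z) g(z)`. Unlike in `toeplitz`, the symbol need not lie in the Schur class, so
differences of Toeplitz operators are covered. -/
def HasSymbol (M : HardyTwo E →L[ℂ] HardyTwo E') (Φ : 𝔻 → E →L[ℂ] E') : Prop :=
  ∀ g z, (M g).eval z = Φ z (g.eval z)

namespace HasSymbol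

variable {M N : HardyTwo E →L[ℂ] HardyTwo E'} {Φ Ψ : 𝔻 → E →L[ℂ] E'}

protected theorem comp {K : HardyTwo E' →L[ℂ] HardyTwo G} {Θ : 𝔻 → E' →L[ℂ] G}
    (hK : HasSymbol K Θ) (hM : HasSymbol M Φ) : HasSymbol (K ∘L M) fun z => Θ z ∘L Φ z :=
  fun g z => by rw [comp_apply, hK, hM, comp_apply]

variable [CompleteSpace E']

protected theorem sub (hM : HasSymbol M Φ) (hN : HasSymbol N Ψ) :
    HasSymbol (M - N) fun z => Φ z - Ψ z := fun g z => by
  rw [sub_apply, HardyTwo.eval_sub, hM, hN, sub_apply]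

theorem operator_unique (hM : HasSymbol M Φ) (hN : HasSymbol N Φ) : M = N :=
  ContinuousLinearMap.ext fun g => HardyTwo.eval_injective fun z => by rw [hM, hN]

theorem eq_zero_iff (hM : HasSymbol M Φ) : M = 0 ↔ ∀ z, Φ z = 0 := by
  constructor
  · rintro rfl z
    ext x
    simpa [HardyTwo.eval_single, HardyTwo.eval_zero] using (hM (lp.single 2 0 x) z).symm
  · intro hΦ
    refine hM.operator_unique fun g z => ?_
    rw [hΦ, zero_apply, zero_apply, HardyTwo.eval_zero]

variable [CompleteSpace E]

/-- A constant symbol commutes with scalars, so `M` maps Szegő kernel functions to Szegő kernel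
functions. -/
theorem adjoint_const {T : E →L[ℂ] E'} (hM : HasSymbol M fun _ => T) :
    HasSymbol (M†) fun _ => T† := by
  intro g z
  have hkernel : M ∘L (evalCLM E z)† = (evalCLM E' z)† ∘L T := by
    refine ContinuousLinearMap.ext fun y => HardyTwo.eval_injective fun w => ?_
    have hE := DFunLike.congr_fun (evalCLM_comp_adjoint_evalCLM w z) y
    have hE' := DFunLike.congr_fun (evalCLM_comp_adjoint_evalCLM w z) (T y)
    simp only [comp_apply, evalCLM_apply] at hE hE'
    rw [comp_apply, hM, hE, comp_apply, hE']
    simp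
  have hadj := congrArg adjoint hkernel
  rw [adjoint_comp, adjoint_comp, adjoint_adjoint, adjoint_adjoint] at hadj
  exact DFunLike.congr_fun hadj g

theorem eq_smul_comp_adjoint_evalCLM (hM : HasSymbol M Φ) (z : 𝔻) :
    Φ z = (1 - (z : ℂ) * conj (z : ℂ)) • (evalCLM E' z ∘L M ∘L (evalCLM E z)†) := by
  have hne : 1 - (z : ℂ) * conj (z : ℂ) ≠ 0 :=
    (isUnit_one_sub_of_norm_lt_one (norm_mul_conj_lt_one z z)).ne_zero
  have hcomp : evalCLM E' z ∘L M = Φ z ∘L evalCLM E z := by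
    ext g
    exact hM g z
  rw [← comp_assoc, hcomp, comp_assoc, evalCLM_comp_adjoint_evalCLM, comp_smul, smul_smul,
    mul_inv_cancel₀ hne, one_smul, one_def, comp_id]

theorem norm_symbol_le (hM : HasSymbol M Φ) (z : 𝔻) : ‖Φ z‖ ≤ ‖M‖ := by
  set κ := 1 - (z : ℂ) * conj (z : ℂ)
  calc ‖Φ z‖ ≤ ‖κ‖ * (‖evalCLM E' z‖ * ‖M‖ * ‖evalCLM E z‖) := by
        rw [hM.eq_smul_comp_adjoint_evalCLM z, norm_smul,
          ← LinearIsometryEquiv.norm_map adjoint (evalCLM E z)]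
        gcongr
        exact norm_comp_comp_le _ _ _
    _ ≤ ‖κ‖ * (√‖κ‖⁻¹ * ‖M‖ * √‖κ‖⁻¹) := by gcongr <;> exact norm_evalCLM_le z
    _ = ‖κ‖ * ‖κ‖⁻¹ * ‖M‖ := by
        rw [mul_right_comm √‖κ‖⁻¹, Real.mul_self_sqrt (by positivity), mul_assoc]
    _ ≤ ‖M‖ := mul_le_of_le_one_left (norm_nonneg M) mul_inv_le_one

theorem norm_le_of_forall_norm_symbol_le (hM : HasSymbol M Φ) {c : ℝ}
    (hΦ : ∀ z, ‖Φ z‖ ≤ c) : ‖M‖ ≤ c := by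
  have hc : 0 ≤ c := (norm_nonneg _).trans (hΦ 0)
  refine opNorm_le_bound _ hc fun g => ?_
  have hnorm : ‖(c : ℂ) • g‖ = c * ‖g‖ := by
    rw [norm_smul, Complex.norm_real, Real.norm_of_nonneg hc]
  have hsum := sum_coeff_sq_le ((c : ℂ) • g) (fun n => M g n)
    (fun z hz => summable_norm_pow (coeff_le (M g)) hz) fun z hz => by
      change ‖(M g).eval (.mk z hz)‖ ≤ ‖HardyTwo.eval ((c : ℂ) • g) (.mk z hz)‖
      rw [hM, HardyTwo.eval_smul, norm_smul, Complex.norm_real, Real.norm_of_nonneg hc]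
      exact le_of_opNorm_le _ (hΦ _) _
  rw [hnorm] at hsum
  exact lp.norm_le_of_forall_sum_le (by norm_num) (by positivity) fun s => by simpa using hsum s

theorem norm_eq_hInfinityNorm (hM : HasSymbol M Φ) : ‖M‖ = hInfinityNorm Φ := by
  have hbdd : BddAbove (Set.range fun z => ‖Φ z‖) := ⟨‖M‖, Set.forall_mem_range.2 hM.norm_symbol_le⟩
  exact le_antisymm (hM.norm_le_of_forall_norm_symbol_le (le_ciSup hbdd))
    (ciSup_le hM.norm_symbol_le)

theorem isStarOrthogonal_const_iff {T : E →L[ℂ] E'} (hM : HasSymbol M fun _ => T)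
    (hN : HasSymbol N Ψ) : IsStarOrthogonal M N ↔ ∀ z, IsStarOrthogonal T (Ψ z) := by
  simp only [IsStarOrthogonal, forall_and]
  exact and_congr (hM.adjoint_const.comp hN).eq_zero_iff (hN.comp hM.adjoint_const).eq_zero_iff

theorem isPartialIsometry_const {T : E →L[ℂ] E'} (hM : HasSymbol M fun _ => T)
    (hT : IsPartialIsometry T) : IsPartialIsometry M := by
  have hcomp := hM.comp (hM.adjoint_const.comp hM)
  simp only [show T ∘L T† ∘L T = T from hT] at hcomp
  exact hcomp.operator_unique hM

end HasSymbol

/-! ### The equivalence class of a constant partial isometry -/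

variable [CompleteSpace E] [CompleteSpace E'] {T : E →L[ℂ] E'}

theorem hasSymbol_toeplitz (F : SchurClass E E') : HasSymbol (toeplitz F) F.1 :=
  toeplitz_eval F

theorem mem_equivalenceClass_const_iff (hT : IsPartialIsometry T) (F : SchurClass E E') :
    F ∈ equivalenceClass (SchurClass.const T hT.norm_le_one) ↔
      (∀ z, IsStarOrthogonal T (F.1 z - T)) ∧ hInfinityNorm (fun z => F.1 z - T) < 1 := by
  have hconst : HasSymbol (toeplitz (SchurClass.const T hT.norm_le_one)) fun _ => T :=
    hasSymbol_toeplitz _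
  have hdiff := (hasSymbol_toeplitz F).sub hconst
  rw [← hconst.isStarOrthogonal_const_iff hdiff, ← hdiff.norm_eq_hInfinityNorm]
  exact (hconst.isPartialIsometry_const hT).shmulyanDominatedBy_and_symm_iff (norm_toeplitz_le F)

theorem IsHInfinity.sub_const {V W : Type*} [NormedAddCommGroup V] [NormedSpace ℂ V]
    [NormedAddCommGroup W] [NormedSpace ℂ W] {F : 𝔻 → V →L[ℂ] W} (hF : IsHInfinity F)
    (T : V →L[ℂ] W) : IsHInfinity fun z => F z - T := by
  obtain ⟨⟨f, hf, hFf⟩, b, hb⟩ := hF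
  refine ⟨⟨fun z => f z - T, hf.sub_const T, fun z => congrArg (· - T) (hFf z)⟩, b + ‖T‖, ?_⟩
  rintro _ ⟨z, rfl⟩
  exact (norm_sub_le _ _).trans (add_le_add_left (hb ⟨z, rfl⟩) _)

theorem AnalyticOnDisc.defectCompression {F : 𝔻 → E →L[ℂ] E'} (hF : AnalyticOnDisc F)
    (T : E →L[ℂ] E') : AnalyticOnDisc fun z => defectCompression T (F z) := by
  obtain ⟨f, hf, hFf⟩ := hF
  refine ⟨fun z => ShmulyanTerHorst.defectCompression T (f z), ?_, fun z => congrArg _ (hFf z)⟩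
  exact (differentiableOn_const _).clm_comp (hf.clm_comp (differentiableOn_const _))

theorem IsHInfinity.exists_defectCompression {C : 𝔻 → E →L[ℂ] E'} (hC : IsHInfinity C)
    (hT : ‖T‖ ≤ 1) (hlt : hInfinityNorm C < 1) :
    ∃ F₀ : SchurClass (defectSpace T) (defectSpace (T†)),
      hInfinityNorm F₀.1 < 1 ∧ ∀ z, F₀.1 z = defectCompression T (C z) := by
  have hle : ∀ z, ‖defectCompression T (C z)‖ ≤ hInfinityNorm C := fun z =>
    (norm_defectCompression_le hT _).trans (le_ciSup hC.2 z)
  have hsup : hInfinityNorm (fun z => defectCompression T (C z)) ≤ hInfinityNorm C := ciSup_le hle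
  exact ⟨⟨fun z => defectCompression T (C z),
    ⟨hC.1.defectCompression T, _, Set.forall_mem_range.2 hle⟩, (hsup.trans_lt hlt).le⟩,
    hsup.trans_lt hlt, fun _ => rfl⟩

theorem exists_eq_defectPerturbation_iff (hT : IsPartialIsometry T) (F : SchurClass E E') :
    (∃ F₀ : SchurClass (defectSpace T) (defectSpace (T†)),
      hInfinityNorm F₀.1 < 1 ∧ ∀ z, F.1 z = defectPerturbation T (F₀.1 z)) ↔
      (∀ z, IsStarOrthogonal T (F.1 z - T)) ∧ hInfinityNorm (fun z => F.1 z - T) < 1 := by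
  constructor
  · rintro ⟨F₀, hlt, hF⟩
    refine ⟨fun z => ?_, (ciSup_le fun z => ?_).trans_lt hlt⟩
    · rw [hF]
      exact hT.isStarOrthogonal_defectPerturbation_sub _
    · simp only [hF]
      exact (norm_defectPerturbation_sub_le hT.norm_le_one _).trans (le_ciSup F₀.2.1.2 z)
  · rintro ⟨horth, hlt⟩
    obtain ⟨F₀, hF₀, heq⟩ := (F.2.1.sub_const T).exists_defectCompression hT.norm_le_one hlt
    refine ⟨F₀, hF₀, fun z => ?_⟩
    rw [heq, hT.defectPerturbation_defectCompression_sub (horth z)]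

end Hardy

end ShmulyanTerHorst

open ShmulyanTerHorst in
theorem mainTheorem7_general {E E' : Type*}
    [NormedAddCommGroup E] [InnerProductSpace ℂ E] [CompleteSpace E]
    [NormedAddCommGroup E'] [InnerProductSpace ℂ E'] [CompleteSpace E']
    (T : E →L[ℂ] E') (hT : IsPartialIsometry T) :
    equivalenceClass (SchurClass.const T hT.norm_le_one) =
      {F : SchurClass E E' |
        ∃ F₀ : SchurClass (defectSpace T) (defectSpace (ContinuousLinearMap.adjoint T)),
          hInfinityNorm F₀.1 < 1 ∧
            ∀ z : Complex.UnitDisc, F.1 z = defectPerturbation T (F₀.1 z)} := by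
  ext F
  exact (mem_equivalenceClass_const_iff hT F).trans (exists_eq_defectPerturbation_iff hT F).symm

theorem mainTheorem7 {E E' : Type*}
    [NormedAddCommGroup E] [InnerProductSpace ℂ E] [CompleteSpace E]
    [TopologicalSpace.SeparableSpace E]
    [NormedAddCommGroup E'] [InnerProductSpace ℂ E'] [CompleteSpace E']
    [TopologicalSpace.SeparableSpace E']
    (T : E →L[ℂ] E') (hT : ShmulyanTerHorst.IsPartialIsometry T) :
    ShmulyanTerHorst.equivalenceClass (ShmulyanTerHorst.SchurClass.const T hT.norm_le_one) =
      {F : ShmulyanTerHorst.SchurClass E E' |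
        ∃ F₀ : ShmulyanTerHorst.SchurClass (ShmulyanTerHorst.defectSpace T)
            (ShmulyanTerHorst.defectSpace (ContinuousLinearMap.adjoint T)),
          ShmulyanTerHorst.hInfinityNorm F₀.1 < 1 ∧
            ∀ z : Complex.UnitDisc,
              F.1 z = ShmulyanTerHorst.defectPerturbation T (F₀.1 z)} :=
  mainTheorem7_general T hT
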